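/- **Theorem.** Let $d \geq 1$ and $T \geq 8$ be integers and let $B > 0$ be a real number. A forecaster (with beforehand-known features) outputs, at each round $t = 1,\dots,T$, a prediction $\hat y_t \in \mathbb{R}$ that is an arbitrary function of the whole feature sequence $\mathbf{x}_1,\dots,\mathbf{x}_T$ and of the past observations $y_1,\dots,y_{t-1}$. Define the minimax uniform regret $$\mathcal{R}^\star_{T,[-B,B]} = \inf_{\text{forecasters}} \ \sup_{\mathbf{x}_1,\dots,\mathbf{x}_T \in [0,1]^d} \ \sup_{y_1,\dots,y_T \in [-B,B]} \left\{ \sum_{t=1}^T (y_t - \hat y_t)^2 - \inf_{\mathbf{u} \in \mathbb{R}^d} \sum_{t=1}^T (y_t - \mathbf{u}\cdot\mathbf{x}_t)^2 \right\},$$ where the suprema are taken in $\mathbb{R} \cup \{+\infty\}$. Then $$\mathcal{R}^\star_{T,[-B,B]} \ \geq\ d B^2 \bigl( \ln T - (3 + \ln d) - \ln\ln T \bigr).$$ -/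

import Mathlib

/-- A (deterministic) forecaster for `T` rounds of online linear regression in dimension `d` with
beforehand-known features. At each round `t` it outputs a real prediction, which is an arbitrary
function of the whole feature sequence `x` and of the observations of the rounds strictly before
`t` (and of nothing else). -/
def Forecaster (d T : ℕ) : Type :=
  (x : Fin T → Fin d → ℝ) → (t : Fin T) → (past : Fin (t : ℕ) → ℝ) → ℝ

namespace Forecaster

variable {d T : ℕ}

/-- The prediction at round `t` when the features are `x` and the observations are `y`:
the forecaster is shown `x` entirely, and only the restriction of `y` to rounds `s < t`. -/
def prediction (F : Forecaster d T) (x : Fin T → Fin d → ℝ) (y : Fin T → ℝ) (t : Fin T) : ℝ :=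
  F x t (fun s => y (Fin.castLE t.isLt.le s))

/-- Cumulative square loss of the forecaster. -/
def loss (F : Forecaster d T) (x : Fin T → Fin d → ℝ) (y : Fin T → ℝ) : ℝ :=
  ∑ t : Fin T, (y t - F.prediction x y t) ^ 2

end Forecaster

/-- Cumulative square loss of the fixed linear predictor `u`. -/
def linearLoss {d T : ℕ} (x : Fin T → Fin d → ℝ) (y : Fin T → ℝ) (u : Fin d → ℝ) : ℝ :=
  ∑ t : Fin T, (y t - u ⬝ᵥ x t) ^ 2

/-- Uniform regret over `ℝᵈ`: cumulative loss of the forecaster minus the infimum over all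
`u ∈ ℝᵈ` of the cumulative loss of `u` (an infimum of a nonempty set of nonnegative reals). -/
noncomputable def uniformRegret {d T : ℕ} (F : Forecaster d T)
    (x : Fin T → Fin d → ℝ) (y : Fin T → ℝ) : ℝ :=
  F.loss x y - ⨅ u : Fin d → ℝ, linearLoss x y u

/-- Minimax uniform regret for beforehand-known features: infimum over forecasters of the supremum
over features in `[0,1]ᵈ` and observations in `[-B,B]` of the uniform regret. It is an extended
real, because the inner supremum is `+∞` for some forecasters. -/
noncomputable def minimaxRegret (d T : ℕ) (B : ℝ) : EReal :=
  ⨅ F : Forecaster d T,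
    ⨆ x ∈ {x : Fin T → Fin d → ℝ | ∀ t i, x t i ∈ Set.Icc (0 : ℝ) 1},
      ⨆ y ∈ {y : Fin T → ℝ | ∀ t, y t ∈ Set.Icc (-B) B},
        ((uniformRegret F x y : ℝ) : EReal)

open Finset

/-! Features cycling through the standard basis split the game into `d` one-dimensional ones, in
which the observations are `±B`. Give the signs in each a symmetric Beta prior of mass `a`: their
predictive mean is `m = s / (c + a)`, and predicting `p` has expected excess `p ^ 2 - 2 B m p ≥ -(B
m) ^ 2`. `potential` rises by exactly `m ^ 2` on average (`potential_average`), so some sign always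
does at least as well as the average, and no randomness is needed. At the end it is at most `s ^ 2 /
n`, the gain of the best constant (`potential_self_le`); at the start it is about `log (n / a)`.
Taking `a = log T` costs `log (log T)` and makes the factor `a / (a + 1)` lose only a constant. -/

/-! ### The one-dimensional Bayesian game -/

/-- The shifted harmonic sum `∑_{j < n} 1 / (j + a)`. -/
noncomputable def shiftedHarmonic (a : ℝ) (n : ℕ) : ℝ := ∑ j ∈ range n, 1 / ((j : ℝ) + a)

/-- The posterior mean of `1 - θ ^ 2` after `c` signs of mean `θ` with sum `s`, when the prior of
`(1 + θ) / 2` is the symmetric Beta distribution of total mass `a`. -/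
noncomputable def posteriorVar (a : ℝ) (c : ℕ) (s : ℝ) : ℝ :=
  ((c + a) ^ 2 - s ^ 2) / ((c + a) * (c + a + 1))

/-- A lower bound on the Bayesian value of the one-dimensional game of length `n`, after `c` rounds
in which the signs add up to `s`. -/
noncomputable def potential (a : ℝ) (n c : ℕ) (s : ℝ) : ℝ :=
  c - posteriorVar a c s * (c + 1 + shiftedHarmonic a c - shiftedHarmonic a n)

theorem log_le_shiftedHarmonic {a : ℝ} (ha : 0 < a) (n : ℕ) :
    Real.log ((n + a) / a) ≤ shiftedHarmonic a n := by
  induction n with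
  | zero => simp [shiftedHarmonic, ha.ne']
  | succ n ih =>
    have hn : (0 : ℝ) < n + a := by positivity
    have h1 : ((n + 1 : ℕ) + a) / a = ((n + a) / a) * (1 + 1 / (n + a)) := by
      push_cast
      field_simp
      ring
    have h2 : Real.log (1 + 1 / (n + a)) ≤ 1 / (n + a) := by
      have := Real.log_le_sub_one_of_pos (x := 1 + 1 / (n + a)) (by positivity)
      linarith
    rw [h1, Real.log_mul (by positivity) (by positivity), shiftedHarmonic, sum_range_succ]
    exact add_le_add ih h2

/-- Posterior expectations are martingales under the predictive law of the next sign. -/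
theorem posteriorVar_average {a : ℝ} (ha : 0 < a) (c : ℕ) (s : ℝ) :
    (1 + s / (c + a)) / 2 * posteriorVar a (c + 1) (s + 1) +
      (1 - s / (c + a)) / 2 * posteriorVar a (c + 1) (s - 1) = posteriorVar a c s := by
  have hc : (0 : ℝ) < c + a := by positivity
  have hc1 : (0 : ℝ) < c + 1 + a := by positivity
  have hc2 : (0 : ℝ) < c + a + 1 := by positivity
  have hc3 : (0 : ℝ) < c + 1 + a + 1 := by positivity
  simp only [posteriorVar]
  push_cast
  field_simp
  ring

theorem potential_average {a : ℝ} (ha : 0 < a) (n c : ℕ) (s : ℝ) :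
    (1 + s / (c + a)) / 2 * potential a n (c + 1) (s + 1) +
      (1 - s / (c + a)) / 2 * potential a n (c + 1) (s - 1) =
        potential a n c s + (s / (c + a)) ^ 2 := by
  have hc : (0 : ℝ) < c + a := by positivity
  have hH : shiftedHarmonic a (c + 1) = shiftedHarmonic a c + 1 / (c + a) := by
    rw [shiftedHarmonic, sum_range_succ, shiftedHarmonic]
  have hq : posteriorVar a c s * (1 + 1 / (c + a)) = 1 - (s / (c + a)) ^ 2 := by
    have hc2 : (0 : ℝ) < c + a + 1 := by positivity
    rw [posteriorVar]
    field_simp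
  have h := posteriorVar_average ha c s
  simp only [potential, hH]
  push_cast
  linear_combination
    (-(c + 1 + 1 + (shiftedHarmonic a c + 1 / (c + a)) - shiftedHarmonic a n)) * h - hq

theorem exists_sign_potential_le {a : ℝ} (ha : 0 < a) (B p : ℝ) (n c : ℕ) {s : ℝ}
    (hs : |s| ≤ c) : ∃ b : ℝ, (b = 1 ∨ b = -1) ∧
      B ^ 2 * potential a n c s ≤ p ^ 2 - 2 * (B * b) * p + B ^ 2 * potential a n (c + 1) (s + b) := by
  have hc : (0 : ℝ) < c + a := by positivity
  have havg := potential_average ha n c s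
  obtain ⟨h1, h2⟩ := abs_le.1 hs
  set m := s / (c + a) with hm
  have hm1 : m ≤ 1 := by rw [hm, div_le_one hc]; linarith
  have hm2 : -1 ≤ m := by rw [hm, le_div_iff₀ hc]; linarith
  by_contra! hcon
  have hp := hcon 1 (Or.inl rfl)
  have hn := hcon (-1) (Or.inr rfl)
  rw [← sub_eq_add_neg] at hn
  -- Completing the square in `p`: the `B ^ 2 * m ^ 2` that it costs is what the potential gains on
  -- average.
  have hsum : (1 + m) / 2 * (p ^ 2 - 2 * (B * 1) * p + B ^ 2 * potential a n (c + 1) (s + 1)) +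
      (1 - m) / 2 * (p ^ 2 - 2 * (B * -1) * p + B ^ 2 * potential a n (c + 1) (s - 1)) =
      (p - B * m) ^ 2 + B ^ 2 * potential a n c s := by
    linear_combination B ^ 2 * havg
  rcases hm2.eq_or_lt with h | h
  · rw [← h] at hsum
    nlinarith [sq_nonneg (p - B * -1)]
  · nlinarith [sq_nonneg (p - B * m), mul_pos (by linarith : 0 < 1 + m) (sub_pos.2 hp),
      mul_nonneg (sub_nonneg.2 hm1) (sub_pos.2 hn).le]

theorem potential_self_le {a : ℝ} (ha : 0 < a) (n : ℕ) {s : ℝ} (hs : |s| ≤ n) :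
    potential a n n s ≤ s ^ 2 / n := by
  rcases n.eq_zero_or_pos with rfl | hn
  · have : s = 0 := by simpa using hs
    subst this
    have : 0 ≤ posteriorVar a 0 0 := by
      rw [posteriorVar]
      norm_num
      positivity
    simpa [potential] using this
  · have hn' : (0 : ℝ) < n := by exact_mod_cast hn
    have key : s ^ 2 / n - potential a n n s =
        (a * n + s ^ 2 * a * (2 * n + a + 1) / (n + a)) / (n * (n + a + 1)) := by
      have : (0 : ℝ) < n + a := by positivity
      have : (0 : ℝ) < n + a + 1 := by positivity
      simp only [potential, posteriorVar]
      field_simp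
      ring
    have : 0 ≤ s ^ 2 / n - potential a n n s := by
      rw [key]
      positivity
    linarith

theorem potential_zero (a : ℝ) (ha : 0 < a) (n : ℕ) :
    potential a n 0 0 = a / (a + 1) * (shiftedHarmonic a n - 1) := by
  simp only [potential, posteriorVar, shiftedHarmonic]
  simp only [Nat.cast_zero, range_zero, sum_empty]
  field_simp
  ring

/-! ### Interleaving `d` games by residue classes -/

/-- The number of rounds before `t` that belong to the residue class `k` modulo `d`. -/
def classCount (d k t : ℕ) : ℕ := Nat.count (fun s => s % d = k) t

/-- The sum of `ε` over the rounds before `t` in the residue class `k` modulo `d`. -/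
def classSum (d k t : ℕ) (ε : ℕ → ℝ) : ℝ := ∑ s ∈ range t, if s % d = k then ε s else 0

theorem classCount_succ (d k t : ℕ) :
    classCount d k (t + 1) = classCount d k t + if t % d = k then 1 else 0 :=
  Nat.count_succ _ _

theorem classSum_succ (d k t : ℕ) (ε : ℕ → ℝ) :
    classSum d k (t + 1) ε = classSum d k t ε + if t % d = k then ε t else 0 :=
  sum_range_succ _ _

theorem classSum_congr {d k t : ℕ} {ε ε' : ℕ → ℝ} (h : ∀ i < t, ε i = ε' i) :
    classSum d k t ε = classSum d k t ε' :=
  sum_congr rfl fun s hs => by rw [h s (mem_range.1 hs)]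

theorem classCount_eq_sum (d k t : ℕ) :
    (classCount d k t : ℝ) = ∑ s ∈ range t, if s % d = k then (1 : ℝ) else 0 := by
  induction t with
  | zero => simp [classCount]
  | succ t ih => rw [classCount_succ, sum_range_succ, ← ih]; push_cast; rfl

theorem abs_classSum_le {ε : ℕ → ℝ} (hε : ∀ i, ε i = 1 ∨ ε i = -1) (d k t : ℕ) :
    |classSum d k t ε| ≤ classCount d k t := by
  rw [classCount_eq_sum]
  refine (abs_sum_le_sum_abs _ _).trans (sum_le_sum fun s _ => ?_)
  split_ifs
  · rcases hε s with h | h <;> simp [h]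
  · simp

theorem div_le_classCount {d k : ℕ} (hk : k < d) (T : ℕ) : T / d ≤ classCount d k T := by
  have h := Nat.count_modEq_card T (by lia : 0 < d) k
  have h2 : classCount d k T = Nat.count (· ≡ k [MOD d]) T := by
    simp only [classCount, Nat.ModEq, Nat.mod_eq_of_lt hk]
  rw [h2, h]
  exact Nat.le_add_right _ _

/-- Against a causal prediction rule `p`, signs can be chosen so that the excess loss is at least
the drop of the total potential. -/
theorem exists_signs_potential_le {a : ℝ} (ha : 0 < a) {d : ℕ} (hd : 0 < d) (B : ℝ) (n : ℕ → ℕ)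
    (p : ℕ → (ℕ → ℝ) → ℝ)
    (hp : ∀ s ε ε', (∀ i < s, ε i = ε' i) → p s ε = p s ε') (t : ℕ) :
    ∃ ε : ℕ → ℝ, (∀ i, ε i = 1 ∨ ε i = -1) ∧
      B ^ 2 * ∑ k ∈ range d, potential a (n k) 0 0 ≤
        ∑ s ∈ range t, (p s ε ^ 2 - 2 * (B * ε s) * p s ε) +
          B ^ 2 * ∑ k ∈ range d, potential a (n k) (classCount d k t) (classSum d k t ε) := by
  induction t with
  | zero => exact ⟨fun _ => 1, fun _ => Or.inl rfl, by simp [classCount, classSum]⟩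
  | succ t ih =>
    obtain ⟨ε, hε, hle⟩ := ih
    obtain ⟨b, hb, hstep⟩ := exists_sign_potential_le ha B (p t ε) (n (t % d)) _
      (abs_classSum_le hε d (t % d) t)
    have hagree : ∀ i < t, Function.update ε t b i = ε i := fun i hi =>
      Function.update_of_ne hi.ne _ _
    have hmem : t % d ∈ range d := mem_range.2 (Nat.mod_lt _ hd)
    -- By causality, changing the sign at `t` affects no prediction up to and including round `t`;
    -- only the class of `t` changes its potential.
    refine ⟨Function.update ε t b, fun i => ?_, hle.trans ?_⟩
    · rcases eq_or_ne i t with rfl | h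
      · simpa using hb
      · simpa [h] using hε i
    · have h1 : ∑ s ∈ range t, (p s (Function.update ε t b) ^ 2 -
          2 * (B * Function.update ε t b s) * p s (Function.update ε t b)) =
          ∑ s ∈ range t, (p s ε ^ 2 - 2 * (B * ε s) * p s ε) :=
        sum_congr rfl fun s hs => by
          have hs := mem_range.1 hs
          rw [hagree s hs, hp s _ ε fun i hi => hagree i (hi.trans hs)]
      have h2 : ∀ k ∈ (range d).erase (t % d),
          potential a (n k) (classCount d k (t + 1))
            (classSum d k (t + 1) (Function.update ε t b)) =
          potential a (n k) (classCount d k t) (classSum d k t ε) := fun k hk => by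
        have hk : ¬ t % d = k := fun h => (mem_erase.1 hk).1 h.symm
        rw [classCount_succ, classSum_succ, if_neg hk, if_neg hk, classSum_congr hagree,
          add_zero, add_zero]
      rw [sum_range_succ, h1, hp t _ ε hagree, ← add_sum_erase _ _ hmem,
        ← add_sum_erase _ (fun k => potential a (n k) (classCount d k (t + 1)) _) hmem,
        sum_congr rfl h2]
      simp only [classCount_succ, classSum_succ, if_true, classSum_congr hagree,
        Function.update_self]
      linarith

theorem sum_range_fiberwise_mod {d : ℕ} (hd : 0 < d) (T : ℕ) (f : ℕ → ℝ) :
    ∑ s ∈ range T, f s = ∑ k ∈ range d, ∑ s ∈ range T, if s % d = k then f s else 0 := by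
  rw [sum_comm]
  refine sum_congr rfl fun s _ => ?_
  rw [sum_ite_eq, if_pos (mem_range.2 (Nat.mod_lt _ hd))]

/-! ### From signs to regret -/

/-- The features that run cyclically through the standard basis. -/
def cyclicFeatures (d T : ℕ) (t : Fin T) (k : Fin d) : ℝ := if (t : ℕ) % d = k then 1 else 0

theorem dotProduct_cyclicFeatures {d T : ℕ} (hd : 0 < d) (u : ℕ → ℝ) (t : Fin T) :
    (fun k : Fin d => u k) ⬝ᵥ cyclicFeatures d T t = u (t % d) := by
  have h : ∀ k : Fin d, ((t : ℕ) % d = k) ↔ (⟨t % d, Nat.mod_lt _ hd⟩ : Fin d) = k := fun k => by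
    rw [Fin.ext_iff]
  simp only [dotProduct, cyclicFeatures, mul_ite, mul_one, mul_zero, h]
  rw [sum_ite_eq, if_pos (mem_univ _)]

theorem iInf_linearLoss_cyclicFeatures_le {d T : ℕ} (hd : 0 < d) (B : ℝ) {ε : ℕ → ℝ}
    (hε : ∀ i, ε i = 1 ∨ ε i = -1) :
    ⨅ u, linearLoss (cyclicFeatures d T) (fun t => B * ε t) u ≤
      T * B ^ 2 - B ^ 2 * ∑ k ∈ range d, classSum d k T ε ^ 2 / classCount d k T := by
  -- Least squares: the mean observation of each class, or `0` on an empty class since `x / 0 = 0`.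
  set u : ℕ → ℝ := fun k => B * (classSum d k T ε / classCount d k T) with hu
  refine (ciInf_le ⟨0, ?_⟩ fun k : Fin d => u k).trans (le_of_eq ?_)
  · rintro _ ⟨v, rfl⟩
    exact sum_nonneg fun t _ => sq_nonneg _
  · have h1 : linearLoss (cyclicFeatures d T) (fun t => B * ε t) (fun k : Fin d => u k) =
        ∑ s ∈ range T, (B ^ 2 + (u (s % d) ^ 2 - 2 * B * u (s % d) * ε s)) := by
      rw [linearLoss, ← Fin.sum_univ_eq_sum_range
        (fun s => B ^ 2 + (u (s % d) ^ 2 - 2 * B * u (s % d) * ε s))]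
      refine sum_congr rfl fun t _ => ?_
      rw [dotProduct_cyclicFeatures hd]
      have : ε t ^ 2 = 1 := by rcases hε t with h | h <;> simp [h]
      linear_combination B ^ 2 * this
    have h2 : ∀ k, (∑ s ∈ range T, if s % d = k then
        (u (s % d) ^ 2 - 2 * B * u (s % d) * ε s) else 0) =
        -(B ^ 2 * (classSum d k T ε ^ 2 / classCount d k T)) := fun k => by
      have h3 : (∑ s ∈ range T, if s % d = k then
          (u (s % d) ^ 2 - 2 * B * u (s % d) * ε s) else 0) =
          u k ^ 2 * classCount d k T - 2 * B * u k * classSum d k T ε := by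
        rw [classCount_eq_sum, classSum, mul_sum, mul_sum, ← sum_sub_distrib]
        refine sum_congr rfl fun s _ => ?_
        split_ifs with h
        · rw [h, mul_one]
        · simp
      rw [h3, hu]
      rcases eq_or_ne (classCount d k T : ℝ) 0 with h | h
      · simp [h]
      · field_simp
        ring
    rw [h1, sum_add_distrib, sum_range_fiberwise_mod hd T fun s =>
      u (s % d) ^ 2 - 2 * B * u (s % d) * ε s, sum_congr rfl fun k _ => h2 k, sum_neg_distrib,
      ← mul_sum]
    simp
    ring

theorem Forecaster.loss_signs {d T : ℕ} (F : Forecaster d T) (x : Fin T → Fin d → ℝ) (B : ℝ)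
    {ε : ℕ → ℝ} (hε : ∀ i, ε i = 1 ∨ ε i = -1) :
    F.loss x (fun t => B * ε t) = T * B ^ 2 +
      ∑ t : Fin T, (F.prediction x (fun t => B * ε t) t ^ 2 -
        2 * (B * ε t) * F.prediction x (fun t => B * ε t) t) := by
  have h : (T : ℝ) * B ^ 2 = ∑ _t : Fin T, B ^ 2 := by simp
  rw [h, ← sum_add_distrib, Forecaster.loss]
  refine sum_congr rfl fun t _ => ?_
  have : ε t ^ 2 = 1 := by rcases hε t with h | h <;> simp [h]
  linear_combination B ^ 2 * this

theorem exists_signs_uniformRegret_ge {a : ℝ} (ha : 0 < a) {d T : ℕ} (hd : 0 < d) (B : ℝ)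
    (F : Forecaster d T) : ∃ ε : ℕ → ℝ, (∀ i, ε i = 1 ∨ ε i = -1) ∧
      B ^ 2 * ∑ k ∈ range d, potential a (classCount d k T) 0 0 ≤
        uniformRegret F (cyclicFeatures d T) (fun t => B * ε t) := by
  set x := cyclicFeatures d T with hx
  set p : ℕ → (ℕ → ℝ) → ℝ := fun s ε =>
    -- The value `0` from round `T` on is never summed.
    if h : s < T then F.prediction x (fun t => B * ε t) ⟨s, h⟩ else 0 with hpdef
  have hp : ∀ s ε ε', (∀ i < s, ε i = ε' i) → p s ε = p s ε' := fun s ε ε' h => by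
    simp only [hpdef]
    split_ifs
    · simp only [Forecaster.prediction]
      congr 1
      funext i
      simp [h i i.isLt]
    · rfl
  obtain ⟨ε, hε, hle⟩ :=
    exists_signs_potential_le ha hd B (fun k => classCount d k T) p hp T
  refine ⟨ε, hε, hle.trans ?_⟩
  have h1 : ∑ s ∈ range T, (p s ε ^ 2 - 2 * (B * ε s) * p s ε) =
      F.loss x (fun t => B * ε t) - T * B ^ 2 := by
    rw [F.loss_signs x B hε,
      ← Fin.sum_univ_eq_sum_range (fun s => p s ε ^ 2 - 2 * (B * ε s) * p s ε)]
    simp [hpdef]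
  have h2 : ∑ k ∈ range d, potential a (classCount d k T) (classCount d k T) (classSum d k T ε) ≤
      ∑ k ∈ range d, classSum d k T ε ^ 2 / classCount d k T :=
    sum_le_sum fun k _ => potential_self_le ha _ (abs_classSum_le hε d k T)
  have h3 := iInf_linearLoss_cyclicFeatures_le (T := T) hd B hε
  have h4 := mul_le_mul_of_nonneg_left h2 (sq_nonneg B)
  rw [h1, uniformRegret]
  linarith

/-! ### Tuning the prior mass -/

theorem le_potential_zero {d T k : ℕ} (hk : k < d) (hT : 8 ≤ T) :
    Real.log T - (3 + Real.log d) - Real.log (Real.log T) ≤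
      potential (Real.log T) (classCount d k T) 0 0 := by
  have hd : (1 : ℝ) ≤ d := by exact_mod_cast (by lia : 1 ≤ d)
  have hT' : (8 : ℝ) ≤ T := by exact_mod_cast hT
  have hL : 1 ≤ Real.log T := by
    rw [Real.le_log_iff_exp_le (by linarith)]
    linarith [Real.exp_one_lt_d9]
  set L := Real.log T
  have hL0 : 0 < L := by linarith
  set M := L - Real.log d - Real.log L with hM
  have hML : M ≤ L := by
    linarith [Real.log_nonneg hd, Real.log_nonneg hL]
  -- The mass `L ≥ 1` absorbs the rounding in `T / d`.
  have hn : (T : ℝ) / d ≤ classCount d k T + L := by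
    have h1 : (T : ℝ) / d < (T / d : ℕ) + 1 := by
      rw [div_lt_iff₀ (by linarith)]
      exact_mod_cast (Nat.div_lt_iff_lt_mul (by lia)).1 (Nat.lt_succ_self (T / d))
    have h2 : ((T / d : ℕ) : ℝ) ≤ classCount d k T := by
      exact_mod_cast div_le_classCount hk T
    linarith
  have hH : M ≤ shiftedHarmonic L (classCount d k T) := by
    refine le_trans ?_ (log_le_shiftedHarmonic hL0 _)
    rw [hM, ← Real.log_div (by linarith) (by linarith),
      ← Real.log_div (by positivity) hL0.ne']
    exact Real.log_le_log (by positivity) (by gcongr)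
  rw [potential_zero L hL0]
  have h1 : L / (L + 1) * (M - 1) ≤
      L / (L + 1) * (shiftedHarmonic L (classCount d k T) - 1) := by gcongr
  -- After clearing denominators this is `M ≤ 2 * L + 3`, which follows from `M ≤ L`.
  have h2 : M - 3 ≤ L / (L + 1) * (M - 1) := by
    rw [div_mul_eq_mul_div, le_div_iff₀ (by linarith)]
    nlinarith
  linarith

theorem mainTheorem3 (d T : ℕ) (hd : 1 ≤ d) (hT : 8 ≤ T) (B : ℝ) (hB : 0 < B) :
    (((d : ℝ) * B ^ 2 *
        (Real.log (T : ℝ) - (3 + Real.log (d : ℝ)) - Real.log (Real.log (T : ℝ))) : ℝ) : EReal)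
      ≤ minimaxRegret d T B := by
  have hL : 0 < Real.log T := Real.log_pos (by exact_mod_cast (by lia : 1 < T))
  refine le_iInf fun F => ?_
  obtain ⟨ε, hε, hle⟩ := exists_signs_uniformRegret_ge hL hd B F
  refine le_iSup₂_of_le (cyclicFeatures d T) (fun t i => ?_) <|
    le_iSup₂_of_le (fun t : Fin T => B * ε t) (fun t => ?_) <|
      EReal.coe_le_coe_iff.2 (le_trans ?_ hle)
  · rw [cyclicFeatures]
    split_ifs <;> simp
  · rcases hε t with h | h <;> simp [h, hB.le]
  · have h := card_nsmul_le_sum (range d)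
      (fun k => potential (Real.log T) (classCount d k T) 0 0) _
      fun k hk => le_potential_zero (mem_range.1 hk) hT
    rw [card_range, nsmul_eq_mul] at h
    have := mul_le_mul_of_nonneg_left h (sq_nonneg B)
    linarith
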